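/- Let $I=[0,1)$. For $x\in I$ write $x=\sum_{k\ge 0}x_k2^{-k-1}$ with $x_k\in\{0,1\}$ (choosing for dyadic rationals the expansion that terminates in zeros), and for $n\in\mathbb N=\{0,1,2,\dots\}$ write $n=\sum_{k\ge0}n_k2^k$ with $n_k\in\{0,1\}$. Let $r_k(x)=(-1)^{x_k}$ be the Rademacher functions and $\omega_n=\prod_{k\ge 0}r_k^{n_k}$ the Walsh–Paley functions on $I$. For $k\in\mathbb N$ let $$D_k^{\triangle}(x^1,x^2)=\sum_{i=0}^{k-1}\sum_{j=0}^{k-i-1}\omega_i(x^1)\,\omega_j(x^2)\qquad((x^1,x^2)\in I^2)$$ be the triangular Dirichlet kernels, and for $n\ge1$ let $$K_n^{\triangle}=\frac1n\sum_{k=0}^{n-1}D_k^{\triangle}$$ be the triangular Fejér kernels. Then there is an absolute constant $C$ such that for every integer $n\ge1$ the function $K_n^{\triangle}$ is integrable on $I^2$ with respect to Lebesgue measure and $$\|K_n^{\triangle}\|_1=\int_{I^2}|K_n^{\triangle}(x)|\,dx\le C.$$ -/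

import Mathlib

open MeasureTheory

noncomputable section

/-- The `k`-th binary digit `x_k` of `x ∈ [0,1)`, where `x = ∑ x_k 2^{-k-1}`; dyadic rationals
get the expansion that terminates in zeros. -/
def dyadicDigit (k : ℕ) (x : ℝ) : ℕ := ⌊(2 : ℝ) ^ (k + 1) * x⌋₊ % 2

/-- The Rademacher function `r_k(x) = (-1)^{x_k}`. -/
def rademacher (k : ℕ) (x : ℝ) : ℝ := (-1) ^ dyadicDigit k x

/-- The `k`-th binary digit `n_k` of `n`, where `n = ∑ n_k 2^k`. -/
def natDigit (k n : ℕ) : ℕ := n / 2 ^ k % 2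

/-- The Walsh-Paley function `ω_n = ∏_k r_k^{n_k}`. The digits `n_k` with `k > log₂ n` vanish,
so that the product stops at `k = |n| = ⌊log₂ n⌋`. -/
def walsh (n : ℕ) (x : ℝ) : ℝ :=
  ∏ k ∈ Finset.range (Nat.log 2 n + 1), rademacher k x ^ natDigit k n

/-- The triangular Dirichlet kernel
`D_k^△(x¹, x²) = ∑_{i=0}^{k-1} ∑_{j=0}^{k-i-1} ω_i(x¹) ω_j(x²)`. -/
def triangularDirichletKernel (k : ℕ) (x : ℝ × ℝ) : ℝ :=
  ∑ i ∈ Finset.range k, ∑ j ∈ Finset.range (k - i), walsh i x.1 * walsh j x.2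

/-- The triangular Fejér kernel `K_n^△ = (1/n) ∑_{k=0}^{n-1} D_k^△`. -/
def triangularFejerKernel (n : ℕ) (x : ℝ × ℝ) : ℝ :=
  (1 / (n : ℝ)) * ∑ k ∈ Finset.range n, triangularDirichletKernel k x

/-- The unit square `I² = [0,1) × [0,1)`. -/
def unitSquare : Set (ℝ × ℝ) := Set.Ico (0 : ℝ) 1 ×ˢ Set.Ico (0 : ℝ) 1

end

/-! Since `D_0` vanishes, `(n+1) K_{n+1}` is `fejerSum` at `n`, so a bound for its L¹ norm linear in
`n` suffices. On the quarter of the square with leading digits `(a, b)`, put `r = (-1)^a`, `r' =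
(-1)^b`. There the generating series of the Walsh sequences become `(1 + rz)u(z²)` and `(1 +
r'z)v(z²)`, and `1/(1-z) = (1+z)/(1-z²)`. So the diagonal, triangular and Fejér series are those in
`z²` multiplied by `(1+z)^s (1+rz)(1+r'z)` with `s = 0, 1, 2`.

For `s = 1, 2` the multiplier contains `1-z²` as soon as `r` or `r'` is `-1`, which turns Fejér sums
into triangular ones and triangular into diagonal ones. Only the quarter `r = r' = 1` reproduces the
same kind of sum. It has a quarter of the mass, and the coefficients of `(1+z)^4` in each residue
class mod 2 add up to 8. Doubling `n` thus doubles the Fejér norm, up to lower-order triangular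
terms. Diagonal and triangular norms grow at most like `(7/4)^k` for `n ≤ 2^k`; as `7/4 < 2`, the
errors sum to a linear bound. -/

/-! ### Doubling recursions for sums over diagonals and triangles -/

/-- The coefficient `∑_{i+j=n-1} u_i v_j` of the product of two sequences. -/
noncomputable def diagSum (u v : ℕ → ℝ) (n : ℕ) : ℝ := ∑ i ∈ Finset.range n, u i * v (n - 1 - i)

/-- The triangular partial sums `∑_{i+j<n} u_i v_j`. -/
noncomputable def triSum (u v : ℕ → ℝ) (n : ℕ) : ℝ := ∑ l ∈ Finset.range n, diagSum u v (l + 1)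

/-- The weighted triangular sums `∑_{i+j<n} (n-i-j) u_i v_j`. -/
noncomputable def fejerSum (u v : ℕ → ℝ) (n : ℕ) : ℝ := ∑ l ∈ Finset.range n, triSum u v (l + 1)

lemma sum_range_two_mul (f : ℕ → ℝ) (m : ℕ) :
    ∑ i ∈ Finset.range (2 * m), f i = ∑ i ∈ Finset.range m, (f (2 * i) + f (2 * i + 1)) := by
  induction m with
  | zero => simp
  | succ m ih =>
    rw [Finset.sum_range_succ, ← ih, show 2 * (m + 1) = 2 * m + 1 + 1 by ring,
      Finset.sum_range_succ, Finset.sum_range_succ]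
    ring

section Recursion

variable {U V u v : ℕ → ℝ} {r r' : ℝ}

/-- The odd-degree part of `(1+rz)(1+r'z)`. The index `n` stands for degree `n - 1`, so even indices
are odd degrees. -/
lemma diagSum_two_mul_add_two (hU : ∀ m, U (2 * m) = u m) (hU' : ∀ m, U (2 * m + 1) = r * u m)
    (hV : ∀ m, V (2 * m) = v m) (hV' : ∀ m, V (2 * m + 1) = r' * v m) (m : ℕ) :
    diagSum U V (2 * m + 2) = (r + r') * diagSum u v (m + 1) := by
  unfold diagSum
  rw [show 2 * m + 2 = 2 * (m + 1) by ring, sum_range_two_mul, Finset.mul_sum]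
  refine Finset.sum_congr rfl fun i hi => ?_
  have hi := Finset.mem_range.1 hi
  rw [show 2 * (m + 1) - 1 - 2 * i = 2 * (m + 1 - 1 - i) + 1 by omega,
    show 2 * (m + 1) - 1 - (2 * i + 1) = 2 * (m + 1 - 1 - i) by omega, hU, hU', hV, hV']
  ring

lemma diagSum_two_mul_add_one (hU : ∀ m, U (2 * m) = u m) (hU' : ∀ m, U (2 * m + 1) = r * u m)
    (hV : ∀ m, V (2 * m) = v m) (hV' : ∀ m, V (2 * m + 1) = r' * v m) (m : ℕ) :
    diagSum U V (2 * m + 1) = diagSum u v (m + 1) + r * r' * diagSum u v m := by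
  unfold diagSum
  rw [Finset.sum_range_succ, sum_range_two_mul, Finset.sum_range_succ, Finset.mul_sum,
    Finset.sum_add_distrib, hU]
  have h1 : ∀ i ∈ Finset.range m, U (2 * i) * V (2 * m + 1 - 1 - 2 * i)
      = u i * v (m + 1 - 1 - i) := fun i hi => by
    have hi := Finset.mem_range.1 hi
    rw [show 2 * m + 1 - 1 - 2 * i = 2 * (m + 1 - 1 - i) by omega, hU, hV]
  have h2 : ∀ i ∈ Finset.range m, U (2 * i + 1) * V (2 * m + 1 - 1 - (2 * i + 1))
      = r * r' * (u i * v (m - 1 - i)) := fun i hi => by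
    have hi := Finset.mem_range.1 hi
    rw [show 2 * m + 1 - 1 - (2 * i + 1) = 2 * (m - 1 - i) + 1 by omega, hU', hV']
    ring
  rw [Finset.sum_congr rfl h1, Finset.sum_congr rfl h2,
    show 2 * m + 1 - 1 - 2 * m = 2 * 0 by omega, hV, show m + 1 - 1 - m = 0 by omega]
  ring

lemma triSum_succ (u v : ℕ → ℝ) (n : ℕ) :
    triSum u v (n + 1) = triSum u v n + diagSum u v (n + 1) := Finset.sum_range_succ _ _

lemma fejerSum_succ (u v : ℕ → ℝ) (n : ℕ) :
    fejerSum u v (n + 1) = fejerSum u v n + triSum u v (n + 1) := Finset.sum_range_succ _ _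

/-- Coefficients of `(1+z)(1+rz)(1+r'z)`, sorted by parity. The two cases feed each other in the
induction. -/
lemma triSum_two_mul_add_one_and_two (hU : ∀ m, U (2 * m) = u m)
    (hU' : ∀ m, U (2 * m + 1) = r * u m)
    (hV : ∀ m, V (2 * m) = v m) (hV' : ∀ m, V (2 * m + 1) = r' * v m) (m : ℕ) :
    triSum U V (2 * m + 1) = triSum u v (m + 1) + (r + r' + r * r') * triSum u v m ∧
    triSum U V (2 * m + 2) = (1 + r + r') * triSum u v (m + 1) + r * r' * triSum u v m := by
  have key : ∀ m, triSum U V (2 * m + 1)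
      = triSum u v (m + 1) + (r + r' + r * r') * triSum u v m → triSum U V (2 * m + 2)
      = (1 + r + r') * triSum u v (m + 1) + r * r' * triSum u v m := fun m h => by
    rw [triSum_succ, h, diagSum_two_mul_add_two hU hU' hV hV', triSum_succ]
    ring
  suffices h : triSum U V (2 * m + 1)
      = triSum u v (m + 1) + (r + r' + r * r') * triSum u v m from ⟨h, key m h⟩
  induction m with
  | zero =>
    have := diagSum_two_mul_add_one hU hU' hV hV' 0
    simp [triSum, diagSum] at this ⊢
    exact this
  | succ m ih =>
    rw [show 2 * (m + 1) + 1 = 2 * m + 2 + 1 by ring, triSum_succ, key m ih,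
      show 2 * m + 2 + 1 = 2 * (m + 1) + 1 by ring, diagSum_two_mul_add_one hU hU' hV hV',
      triSum_succ u v (m + 1), triSum_succ u v m]
    ring

/-- Coefficients of `(1+z)²(1+rz)(1+r'z)`, sorted by parity. -/
lemma fejerSum_two_mul_add_two_and_three (hU : ∀ m, U (2 * m) = u m)
    (hU' : ∀ m, U (2 * m + 1) = r * u m)
    (hV : ∀ m, V (2 * m) = v m) (hV' : ∀ m, V (2 * m + 1) = r' * v m) (m : ℕ) :
    fejerSum U V (2 * m + 2) = (2 + r + r') * fejerSum u v (m + 1)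
      + (r + r' + 2 * (r * r')) * fejerSum u v m ∧
    fejerSum U V (2 * m + 3) = fejerSum u v (m + 2)
      + (1 + 2 * r + 2 * r' + r * r') * fejerSum u v (m + 1) + r * r' * fejerSum u v m := by
  have hT := triSum_two_mul_add_one_and_two hU hU' hV hV'
  have key : ∀ m, fejerSum U V (2 * m + 2) = (2 + r + r') * fejerSum u v (m + 1)
      + (r + r' + 2 * (r * r')) * fejerSum u v m → fejerSum U V (2 * m + 3) = fejerSum u v (m + 2)
      + (1 + 2 * r + 2 * r' + r * r') * fejerSum u v (m + 1) + r * r' * fejerSum u v m :=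
    fun m h => by
      rw [fejerSum_succ, h, show 2 * m + 2 + 1 = 2 * (m + 1) + 1 by ring, (hT _).1,
        fejerSum_succ u v (m + 1), fejerSum_succ u v m]
      ring
  suffices h : fejerSum U V (2 * m + 2) = (2 + r + r') * fejerSum u v (m + 1)
      + (r + r' + 2 * (r * r')) * fejerSum u v m from ⟨h, key m h⟩
  induction m with
  | zero =>
    have h1 := (hT 0).1
    have h2 := (hT 0).2
    simp only [fejerSum_succ, Nat.mul_zero, Nat.zero_add] at h1 h2 ⊢
    have h0 : ∀ u v, fejerSum u v 0 = 0 := fun u v => by simp [fejerSum]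
    have h0' : ∀ u v, triSum u v 0 = 0 := fun u v => by simp [triSum]
    rw [h0, h0, h1, h2, h0']
    ring
  | succ m ih =>
    rw [show 2 * (m + 1) + 2 = 2 * m + 3 + 1 by ring, fejerSum_succ, key m ih,
      show 2 * m + 3 + 1 = 2 * (m + 1) + 2 by ring, (hT _).2,
      fejerSum_succ u v (m + 1), fejerSum_succ u v m]
    ring

end Recursion

/-! ### The kernels as such sums -/

lemma triangularDirichletKernel_eq_triSum (k : ℕ) (p : ℝ × ℝ) :
    triangularDirichletKernel k p = triSum (walsh · p.1) (walsh · p.2) k := by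
  induction k with
  | zero => simp [triangularDirichletKernel, triSum]
  | succ k ih =>
    rw [triSum_succ, ← ih, triangularDirichletKernel, triangularDirichletKernel, diagSum,
      Finset.sum_range_succ, Finset.sum_range_succ]
    have : ∀ i ∈ Finset.range k, ∑ j ∈ Finset.range (k + 1 - i), walsh i p.1 * walsh j p.2 =
        ∑ j ∈ Finset.range (k - i), walsh i p.1 * walsh j p.2
          + walsh i p.1 * walsh (k + 1 - 1 - i) p.2 := fun i hi => by
      have hi := Finset.mem_range.1 hi
      rw [show k + 1 - i = k - i + 1 by omega, Finset.sum_range_succ, Nat.add_sub_cancel]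
    rw [Finset.sum_congr rfl this, Finset.sum_add_distrib, show k + 1 - k = 1 by omega,
      show k + 1 - 1 - k = 0 by omega, Finset.sum_range_one]
    ring

lemma triangularFejerKernel_succ (n : ℕ) (p : ℝ × ℝ) :
    triangularFejerKernel (n + 1) p
      = (1 / ((n + 1 : ℕ) : ℝ)) * fejerSum (walsh · p.1) (walsh · p.2) n := by
  rw [triangularFejerKernel, Finset.sum_range_succ', fejerSum]
  simp only [triangularDirichletKernel_eq_triSum]
  simp [triSum]

/-! ### Walsh functions under a shift of binary digits -/

lemma dyadicDigit_zero_half {t : ℝ} (ht : t ∈ Set.Ico (0 : ℝ) 1) {a : ℕ} (ha : a < 2) :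
    dyadicDigit 0 ((t + a) / 2) = a := by
  have h : ⌊(2 : ℝ) ^ (0 + 1) * ((t + a) / 2)⌋₊ = a := by
    rw [show (2 : ℝ) ^ (0 + 1) * ((t + a) / 2) = t + a by ring, Nat.floor_add_natCast ht.1,
      Nat.floor_eq_zero.2 ht.2, zero_add]
  rw [dyadicDigit, h, Nat.mod_eq_of_lt ha]

lemma dyadicDigit_succ_half {t : ℝ} (ht : 0 ≤ t) (a k : ℕ) :
    dyadicDigit (k + 1) ((t + a) / 2) = dyadicDigit k t := by
  have h : (2 : ℝ) ^ (k + 1 + 1) * ((t + a) / 2) = 2 ^ (k + 1) * t + (2 * (2 ^ k * a) : ℕ) := by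
    push_cast; ring
  rw [dyadicDigit, dyadicDigit, h, Nat.floor_add_natCast (by positivity), Nat.add_mul_mod_self_left]

lemma walsh_eq_prod_range {n K : ℕ} (h : n < 2 ^ K) (x : ℝ) :
    walsh n x = ∏ k ∈ Finset.range K, rademacher k x ^ natDigit k n := by
  have key : ∀ L, n < 2 ^ L → ∀ M, L ≤ M →
      ∏ k ∈ Finset.range L, rademacher k x ^ natDigit k n
        = ∏ k ∈ Finset.range M, rademacher k x ^ natDigit k n := fun L hL M hM =>
    Finset.prod_subset (by simpa using hM) fun k _ hk => by
      have hk : L ≤ k := by simpa using hk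
      rw [natDigit, Nat.div_eq_of_lt (hL.trans_le (Nat.pow_le_pow_right two_pos hk))]
      simp
  rw [walsh, key _ (Nat.lt_pow_succ_log_self one_lt_two n) _ (le_max_left _ K),
    key K h _ (le_max_right _ _)]

/-- Passing from `t` to `(t+a)/2` prepends the digit `a` to `t`, and passing from `m` to `2m+e`
prepends `e` to `m`; only the new factor is added to the product. -/
lemma walsh_half {t : ℝ} (ht : t ∈ Set.Ico (0 : ℝ) 1) {a e : ℕ} (ha : a < 2) (he : e < 2) (m : ℕ) :
    walsh (2 * m + e) ((t + a) / 2) = ((-1) ^ a) ^ e * walsh m t := by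
  have hm : m < 2 ^ m := Nat.lt_two_pow_self
  rw [walsh_eq_prod_range (K := m + 1) (by rw [pow_succ]; omega), walsh_eq_prod_range hm,
    Finset.prod_range_succ', mul_comm]
  congr 1
  · rw [rademacher, dyadicDigit_zero_half ht ha, natDigit,
      show (2 * m + e) / 2 ^ 0 % 2 = e by rw [pow_zero, Nat.div_one]; omega]
  · refine Finset.prod_congr rfl fun k _ => ?_
    rw [rademacher, rademacher, dyadicDigit_succ_half ht.1, natDigit, natDigit, pow_succ',
      ← Nat.div_div_eq_div_mul, show (2 * m + e) / 2 = m by omega]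

lemma measurable_walsh (n : ℕ) : Measurable (walsh n) := by
  unfold walsh rademacher dyadicDigit
  refine Finset.measurable_prod _ fun k _ => Measurable.pow_const ?_ _
  have h : Measurable fun x : ℝ => ⌊(2 : ℝ) ^ (k + 1) * x⌋₊ :=
    Nat.measurable_floor.comp (measurable_const_mul _)
  exact (measurable_from_nat (f := fun j => (-1 : ℝ) ^ (j % 2))).comp h

lemma abs_walsh (n : ℕ) (x : ℝ) : |walsh n x| = 1 := by
  simp [walsh, rademacher, Finset.abs_prod, abs_pow]

/-! ### Integrability and the L¹ norm on the square -/

/-- Lebesgue measure on the unit square. -/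
noncomputable abbrev squareMeasure : Measure (ℝ × ℝ) := volume.restrict unitSquare

lemma measurableSet_unitSquare : MeasurableSet unitSquare :=
  measurableSet_Ico.prod measurableSet_Ico

instance isFiniteMeasure_squareMeasure : IsFiniteMeasure squareMeasure := by
  refine ⟨?_⟩
  rw [Measure.restrict_apply_univ, unitSquare, Measure.volume_eq_prod, Measure.prod_prod]
  simp

lemma squareMeasure_real_univ : squareMeasure.real Set.univ = 1 := by
  rw [measureReal_def, Measure.restrict_apply_univ, unitSquare, Measure.volume_eq_prod,
    Measure.prod_prod]
  simp

lemma integrable_walsh_mul_walsh (i j : ℕ) :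
    Integrable (fun p : ℝ × ℝ => walsh i p.1 * walsh j p.2) squareMeasure := by
  refine Integrable.of_bound (C := 1) (((measurable_walsh i).comp measurable_fst).mul
    ((measurable_walsh j).comp measurable_snd)).aestronglyMeasurable (ae_of_all _ fun p => ?_)
  rw [Real.norm_eq_abs, abs_mul, abs_walsh, abs_walsh, one_mul]

/-- The diagonal sums of the double Walsh system. -/
noncomputable def walshDiag (n : ℕ) (p : ℝ × ℝ) : ℝ := diagSum (walsh · p.1) (walsh · p.2) n

/-- The triangular sums of the double Walsh system. -/
noncomputable def walshTri (n : ℕ) (p : ℝ × ℝ) : ℝ := triSum (walsh · p.1) (walsh · p.2) n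

/-- The weighted triangular sums of the double Walsh system. -/
noncomputable def walshFejer (n : ℕ) (p : ℝ × ℝ) : ℝ := fejerSum (walsh · p.1) (walsh · p.2) n

lemma integrable_walshDiag (n : ℕ) : Integrable (walshDiag n) squareMeasure := by
  unfold walshDiag diagSum
  exact integrable_finsetSum _ fun i _ => integrable_walsh_mul_walsh i (n - 1 - i)

lemma integrable_walshTri (n : ℕ) : Integrable (walshTri n) squareMeasure := by
  unfold walshTri triSum
  exact integrable_finsetSum _ fun l _ => integrable_walshDiag (l + 1)

lemma integrable_walshFejer (n : ℕ) : Integrable (walshFejer n) squareMeasure := by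
  unfold walshFejer fejerSum
  exact integrable_finsetSum _ fun l _ => integrable_walshTri (l + 1)

/-- The `L¹` norm on the unit square. -/
noncomputable def squareNorm (f : ℝ × ℝ → ℝ) : ℝ := ∫ p, |f p| ∂squareMeasure

lemma squareNorm_congr {f g : ℝ × ℝ → ℝ} (h : ∀ p ∈ unitSquare, |f p| = |g p|) :
    squareNorm f = squareNorm g :=
  setIntegral_congr_fun measurableSet_unitSquare h

lemma squareNorm_add_le {f g : ℝ × ℝ → ℝ} (hf : Integrable f squareMeasure)
    (hg : Integrable g squareMeasure) :
    squareNorm (fun p => f p + g p) ≤ squareNorm f + squareNorm g := by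
  rw [squareNorm, squareNorm, squareNorm, ← integral_add hf.abs hg.abs]
  exact integral_mono (hf.add hg).abs (hf.abs.add hg.abs) fun p => abs_add_le _ _

lemma squareNorm_const_mul (c : ℝ) (f : ℝ × ℝ → ℝ) :
    squareNorm (fun p => c * f p) = |c| * squareNorm f := by
  simp only [squareNorm, abs_mul, integral_const_mul]

/-! ### Decomposition into dyadic quarters -/

/-- The contraction of the unit square onto one of its four dyadic quarters. -/
noncomputable def quarterMap (a b : ℕ) (p : ℝ × ℝ) : ℝ × ℝ := ((p.1 + a) / 2, (p.2 + b) / 2)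

/-- A dyadic quarter of the unit square. -/
noncomputable def quarter (a b : ℕ) : Set (ℝ × ℝ) :=
  Set.Ico ((a : ℝ) / 2) ((a + 1) / 2) ×ˢ Set.Ico ((b : ℝ) / 2) ((b + 1) / 2)

lemma measurableSet_quarter (a b : ℕ) : MeasurableSet (quarter a b) :=
  measurableSet_Ico.prod measurableSet_Ico

lemma setIntegral_quarter (a b : ℕ) (g : ℝ × ℝ → ℝ) :
    ∫ p in quarter a b, g p = (1 / 4) * ∫ p in unitSquare, g (quarterMap a b p) := by
  rw [← integral_indicator (measurableSet_quarter a b),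
    ← integral_indicator measurableSet_unitSquare]
  set h := (quarter a b).indicator g with hh
  have h1 : unitSquare.indicator (fun p => g (quarterMap a b p))
      = fun p => h ((1 / 2 : ℝ) • (p + ((a : ℝ), (b : ℝ)))) := by
    funext p
    have e : ((1 / 2 : ℝ) • (p + ((a : ℝ), (b : ℝ)))) = quarterMap a b p := by
      ext <;> simp [quarterMap] <;> ring
    have m : quarterMap a b p ∈ quarter a b ↔ p ∈ unitSquare := by
      simp only [quarterMap, quarter, unitSquare, Set.mem_prod, Set.mem_Ico]
      constructor <;> rintro ⟨⟨_, _⟩, _, _⟩ <;> refine ⟨⟨?_, ?_⟩, ?_, ?_⟩ <;> linarith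
    rw [e, hh]
    by_cases hp : p ∈ unitSquare
    · rw [Set.indicator_of_mem hp, Set.indicator_of_mem (m.2 hp)]
    · rw [Set.indicator_of_notMem hp, Set.indicator_of_notMem (mt m.1 hp)]
  -- Translation invariance, then the scaling by `1/2` in dimension 2, which yields the factor 4.
  rw [h1, integral_add_right_eq_self (fun p => h ((1 / 2 : ℝ) • p)),
    Measure.integral_comp_smul]
  simp
  norm_num
  ring

lemma setIntegral_unitSquare {g : ℝ × ℝ → ℝ} (hg : Integrable g squareMeasure) :
    ∫ p in unitSquare, g p = (∫ p in quarter 0 0, g p) + (∫ p in quarter 0 1, g p)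
      + (∫ p in quarter 1 0, g p) + ∫ p in quarter 1 1, g p := by
  have hu : unitSquare = quarter 0 0 ∪ quarter 0 1 ∪ quarter 1 0 ∪ quarter 1 1 := by
    ext p
    simp only [quarter, unitSquare, Set.mem_prod, Set.mem_Ico, Set.mem_union]
    norm_num
    grind
  have hd : ∀ a b a' b' : ℕ, (a + 1 ≤ a' ∨ b + 1 ≤ b') ∨ (a' + 1 ≤ a ∨ b' + 1 ≤ b) →
      Disjoint (quarter a b) (quarter a' b') := fun a b a' b' h => by
    rw [Set.disjoint_left]
    rintro p ⟨⟨h1, h2⟩, h3, h4⟩ ⟨⟨h5, h6⟩, h7, h8⟩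
    rcases h with (h | h) | (h | h) <;>
    · have : ((_ + 1 : ℕ) : ℝ) ≤ _ := Nat.cast_le.2 h
      push_cast at this
      linarith
  have hi : IntegrableOn g unitSquare := hg
  rw [hu] at hi ⊢
  simp only [integrableOn_union] at hi
  obtain ⟨⟨⟨i1, i2⟩, i3⟩, i4⟩ := hi
  rw [setIntegral_union _ (measurableSet_quarter _ _) ((i1.union i2).union i3) i4,
    setIntegral_union _ (measurableSet_quarter _ _) (i1.union i2) i3,
    setIntegral_union (hd _ _ _ _ (by simp)) (measurableSet_quarter _ _) i1 i2]
  · rw [Set.disjoint_union_left]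
    exact ⟨hd _ _ _ _ (by simp), hd _ _ _ _ (by simp)⟩
  · rw [Set.disjoint_union_left, Set.disjoint_union_left]
    exact ⟨⟨hd _ _ _ _ (by simp), hd _ _ _ _ (by simp)⟩, hd _ _ _ _ (by simp)⟩

lemma squareNorm_eq_quarters {f f₀₀ f₀₁ f₁₀ f₁₁ : ℝ × ℝ → ℝ} (hf : Integrable f squareMeasure)
    (h₀₀ : ∀ p ∈ unitSquare, f (quarterMap 0 0 p) = f₀₀ p)
    (h₀₁ : ∀ p ∈ unitSquare, f (quarterMap 0 1 p) = f₀₁ p)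
    (h₁₀ : ∀ p ∈ unitSquare, f (quarterMap 1 0 p) = f₁₀ p)
    (h₁₁ : ∀ p ∈ unitSquare, f (quarterMap 1 1 p) = f₁₁ p) :
    squareNorm f
      = (squareNorm f₀₀ + squareNorm f₀₁ + squareNorm f₁₀ + squareNorm f₁₁) / 4 := by
  rw [← squareNorm_congr fun p hp => congrArg abs (h₀₀ p hp),
    ← squareNorm_congr fun p hp => congrArg abs (h₀₁ p hp),
    ← squareNorm_congr fun p hp => congrArg abs (h₁₀ p hp),
    ← squareNorm_congr fun p hp => congrArg abs (h₁₁ p hp),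
    squareNorm, setIntegral_unitSquare hf.abs, setIntegral_quarter, setIntegral_quarter,
    setIntegral_quarter, setIntegral_quarter]
  simp only [squareNorm]
  ring

lemma walsh_half_even {t : ℝ} (ht : t ∈ Set.Ico (0 : ℝ) 1) {a : ℕ} (ha : a < 2) (m : ℕ) :
    walsh (2 * m) ((t + a) / 2) = walsh m t := by
  simpa using walsh_half ht ha two_pos m

lemma walsh_half_odd {t : ℝ} (ht : t ∈ Set.Ico (0 : ℝ) 1) {a : ℕ} (ha : a < 2) (m : ℕ) :
    walsh (2 * m + 1) ((t + a) / 2) = (-1) ^ a * walsh m t := by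
  simpa using walsh_half ht ha one_lt_two m

section Quarters

variable {p : ℝ × ℝ} {a b : ℕ}

lemma walshDiag_even_quarterMap (hp : p ∈ unitSquare) (ha : a < 2) (hb : b < 2) (m : ℕ) :
    walshDiag (2 * m + 2) (quarterMap a b p) = ((-1) ^ a + (-1) ^ b) * walshDiag (m + 1) p :=
  diagSum_two_mul_add_two (walsh_half_even hp.1 ha) (walsh_half_odd hp.1 ha)
    (walsh_half_even hp.2 hb) (walsh_half_odd hp.2 hb) m

lemma walshDiag_odd_quarterMap (hp : p ∈ unitSquare) (ha : a < 2) (hb : b < 2) (m : ℕ) :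
    walshDiag (2 * m + 1) (quarterMap a b p)
      = walshDiag (m + 1) p + (-1) ^ a * (-1) ^ b * walshDiag m p :=
  diagSum_two_mul_add_one (walsh_half_even hp.1 ha) (walsh_half_odd hp.1 ha)
    (walsh_half_even hp.2 hb) (walsh_half_odd hp.2 hb) m

lemma walshTri_quarterMap (hp : p ∈ unitSquare) (ha : a < 2) (hb : b < 2) (m : ℕ) :
    walshTri (2 * m + 1) (quarterMap a b p) = walshTri (m + 1) p
      + ((-1) ^ a + (-1) ^ b + (-1) ^ a * (-1) ^ b) * walshTri m p ∧
    walshTri (2 * m + 2) (quarterMap a b p) = (1 + (-1) ^ a + (-1) ^ b) * walshTri (m + 1) p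
      + (-1) ^ a * (-1) ^ b * walshTri m p :=
  triSum_two_mul_add_one_and_two (walsh_half_even hp.1 ha) (walsh_half_odd hp.1 ha)
    (walsh_half_even hp.2 hb) (walsh_half_odd hp.2 hb) m

lemma walshFejer_quarterMap (hp : p ∈ unitSquare) (ha : a < 2) (hb : b < 2) (m : ℕ) :
    walshFejer (2 * m + 2) (quarterMap a b p) = (2 + (-1) ^ a + (-1) ^ b) * walshFejer (m + 1) p
      + ((-1) ^ a + (-1) ^ b + 2 * ((-1) ^ a * (-1) ^ b)) * walshFejer m p ∧
    walshFejer (2 * m + 3) (quarterMap a b p) = walshFejer (m + 2) p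
      + (1 + 2 * (-1) ^ a + 2 * (-1) ^ b + (-1) ^ a * (-1) ^ b) * walshFejer (m + 1) p
      + (-1) ^ a * (-1) ^ b * walshFejer m p :=
  fejerSum_two_mul_add_two_and_three (walsh_half_even hp.1 ha) (walsh_half_odd hp.1 ha)
    (walsh_half_even hp.2 hb) (walsh_half_odd hp.2 hb) m

end Quarters

/-! ### Norm recursions and growth bounds -/

lemma walshTri_succ (n : ℕ) (p : ℝ × ℝ) :
    walshTri (n + 1) p = walshTri n p + walshDiag (n + 1) p := triSum_succ _ _ _

lemma walshFejer_succ (n : ℕ) (p : ℝ × ℝ) :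
    walshFejer (n + 1) p = walshFejer n p + walshTri (n + 1) p := fejerSum_succ _ _ _

lemma squareNorm_mul_add_mul_le {f g : ℝ × ℝ → ℝ} (hf : Integrable f squareMeasure)
    (hg : Integrable g squareMeasure) (c d : ℝ) :
    squareNorm (fun p => c * f p + d * g p) ≤ |c| * squareNorm f + |d| * squareNorm g := by
  rw [← squareNorm_const_mul, ← squareNorm_const_mul]
  exact squareNorm_add_le (hf.const_mul c) (hg.const_mul d)

lemma squareNorm_zero : squareNorm (fun _ => 0) = 0 := by simp [squareNorm]

lemma squareNorm_one : squareNorm (fun _ => 1) = 1 := by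
  rw [squareNorm, integral_const, squareMeasure_real_univ, abs_one, one_smul]

lemma walsh_zero (x : ℝ) : walsh 0 x = 1 := by simp [walsh, natDigit]

lemma walshDiag_zero : walshDiag 0 = fun _ => 0 := by
  funext p; simp [walshDiag, diagSum]

lemma walshDiag_one : walshDiag 1 = fun _ => 1 := by
  funext p; simp [walshDiag, diagSum, walsh_zero]

lemma walshTri_zero : walshTri 0 = fun _ => 0 := by
  funext p; simp [walshTri, triSum]

lemma walshTri_one : walshTri 1 = fun _ => 1 := by
  funext p; simp [walshTri_succ, walshTri_zero, walshDiag_one]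

lemma walshFejer_zero : walshFejer 0 = fun _ => 0 := by
  funext p; simp [walshFejer, fejerSum]

lemma walshFejer_one : walshFejer 1 = fun _ => 1 := by
  funext p; simp [walshFejer_succ, walshFejer_zero, walshTri_one]

/-- The factor `r + r'` is `±2` on two quarters and 0 on the other two, so it has mean modulus 1. -/
lemma squareNorm_walshDiag_even_le (m : ℕ) :
    squareNorm (walshDiag (2 * m + 2)) ≤ squareNorm (walshDiag (m + 1)) := by
  rw [squareNorm_eq_quarters (integrable_walshDiag _)
    (fun p hp => walshDiag_even_quarterMap hp two_pos two_pos m)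
    (fun p hp => walshDiag_even_quarterMap hp two_pos one_lt_two m)
    (fun p hp => walshDiag_even_quarterMap hp one_lt_two two_pos m)
    (fun p hp => walshDiag_even_quarterMap hp one_lt_two one_lt_two m)]
  simp only [squareNorm_const_mul]
  norm_num
  linarith

lemma squareNorm_walshDiag_odd_le (m : ℕ) :
    squareNorm (walshDiag (2 * m + 1)) ≤ squareNorm (walshDiag (m + 1))
      + squareNorm (walshDiag m) := by
  rw [squareNorm_eq_quarters (integrable_walshDiag _)
    (fun p hp => walshDiag_odd_quarterMap hp two_pos two_pos m)
    (fun p hp => walshDiag_odd_quarterMap hp two_pos one_lt_two m)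
    (fun p hp => walshDiag_odd_quarterMap hp one_lt_two two_pos m)
    (fun p hp => walshDiag_odd_quarterMap hp one_lt_two one_lt_two m)]
  have h := squareNorm_mul_add_mul_le (integrable_walshDiag (m + 1)) (integrable_walshDiag m)
  have h1 := h 1 1
  have h2 := h 1 (-1)
  norm_num at h1 h2 ⊢
  linarith

/-- The odd recursion alone would only give growth `2^k`. But one of `m`, `m + 1` is even and costs
no more than its half, so the bounds obey a Fibonacci inequality; `7/4` works because `7/4 + 1 ≤
(7/4)²`. -/
lemma squareNorm_walshDiag_le (k : ℕ) :
    ∀ n ≤ 2 ^ k, squareNorm (walshDiag n) ≤ (7 / 4 : ℝ) ^ k := by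
  have h0 : squareNorm (walshDiag 0) = 0 := by rw [walshDiag_zero, squareNorm_zero]
  have h1 : squareNorm (walshDiag 1) = 1 := by rw [walshDiag_one, squareNorm_one]
  have h2 : squareNorm (walshDiag 2) ≤ 1 := h1 ▸ squareNorm_walshDiag_even_le 0
  induction k using Nat.strong_induction_on with
  | _ k ih =>
    match k, ih with
    | 0, _ =>
      intro n hn
      have : n = 0 ∨ n = 1 := by simp at hn; omega
      rcases this with rfl | rfl <;> simp [h0, h1]
    | 1, _ =>
      intro n hn
      have : n = 0 ∨ n = 1 ∨ n = 2 := by simp at hn; omega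
      rcases this with rfl | rfl | rfl
      · norm_num [h0]
      · norm_num [h1]
      · linarith
    | k + 2, ih =>
      intro n hn
      have i0 := ih k (by omega)
      have i1 := ih (k + 1) (by omega)
      have hq : (0 : ℝ) < (7 / 4) ^ k := by positivity
      have q2 : (7 / 4 : ℝ) ^ (k + 2) = 49 / 16 * (7 / 4) ^ k := by ring
      have q1 : (7 / 4 : ℝ) ^ (k + 1) = 7 / 4 * (7 / 4) ^ k := by ring
      rw [pow_succ, pow_succ] at hn
      rw [pow_succ] at i1
      obtain ⟨m, rfl | rfl⟩ : ∃ m, n = 2 * m ∨ n = 2 * m + 1 := ⟨n / 2, by omega⟩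
      · rcases m with _ | m
        · simp only [Nat.mul_zero, h0]; positivity
        · have := squareNorm_walshDiag_even_le m
          have := i1 (m + 1) (by omega)
          rw [show 2 * (m + 1) = 2 * m + 2 by ring]
          linarith
      · have h := squareNorm_walshDiag_odd_le m
        obtain ⟨l, rfl | rfl⟩ : ∃ l, m = 2 * l ∨ m = 2 * l + 1 := ⟨m / 2, by omega⟩
        · rcases l with _ | l
          · simp only [Nat.mul_zero, h0, h1] at h ⊢
            have : (1 : ℝ) ≤ (7 / 4) ^ (k + 2) := one_le_pow₀ (by norm_num)
            linarith
          · have := squareNorm_walshDiag_even_le l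
            have := i0 (l + 1) (by omega)
            have := i1 (2 * (l + 1) + 1) (by omega)
            rw [show 2 * (l + 1) = 2 * l + 2 by ring] at *
            linarith
        · have := squareNorm_walshDiag_even_le l
          have := i0 (l + 1) (by omega)
          have := i1 (2 * l + 1) (by omega)
          rw [show 2 * l + 1 + 1 = 2 * l + 2 by ring] at h
          linarith

lemma squareNorm_walshTri_even_le (m : ℕ) :
    squareNorm (walshTri (2 * m + 2)) ≤ (3 * squareNorm (walshTri (m + 1))
      + squareNorm (walshTri m) + 3 * squareNorm (walshDiag (m + 1))) / 4 := by
  rw [squareNorm_eq_quarters (f₀₁ := fun p => 1 * walshDiag (m + 1) p)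
    (f₁₀ := fun p => 1 * walshDiag (m + 1) p) (f₁₁ := fun p => (-1) * walshDiag (m + 1) p)
    (integrable_walshTri _)
    (fun p hp => (walshTri_quarterMap hp two_pos two_pos m).2)
    (fun p hp => by
      rw [(walshTri_quarterMap hp two_pos one_lt_two m).2, walshTri_succ]; ring)
    (fun p hp => by
      rw [(walshTri_quarterMap hp one_lt_two two_pos m).2, walshTri_succ]; ring)
    (fun p hp => by
      rw [(walshTri_quarterMap hp one_lt_two one_lt_two m).2, walshTri_succ]; ring)]
  have h := squareNorm_mul_add_mul_le (integrable_walshTri (m + 1)) (integrable_walshTri m) 3 1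
  simp only [squareNorm_const_mul]
  norm_num at h ⊢
  linarith

lemma squareNorm_walshTri_odd_le (m : ℕ) :
    squareNorm (walshTri (2 * m + 1)) ≤ (squareNorm (walshTri (m + 1))
      + 3 * squareNorm (walshTri m) + 3 * squareNorm (walshDiag (m + 1))) / 4 := by
  rw [squareNorm_eq_quarters (f₀₁ := fun p => walshDiag (m + 1) p)
    (f₁₀ := fun p => walshDiag (m + 1) p) (f₁₁ := fun p => walshDiag (m + 1) p)
    (integrable_walshTri _)
    (fun p hp => (walshTri_quarterMap hp two_pos two_pos m).1)
    (fun p hp => by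
      rw [(walshTri_quarterMap hp two_pos one_lt_two m).1, walshTri_succ]; ring)
    (fun p hp => by
      rw [(walshTri_quarterMap hp one_lt_two two_pos m).1, walshTri_succ]; ring)
    (fun p hp => by
      rw [(walshTri_quarterMap hp one_lt_two one_lt_two m).1, walshTri_succ]; ring)]
  have h := squareNorm_mul_add_mul_le (integrable_walshTri (m + 1)) (integrable_walshTri m) 1 3
  norm_num at h ⊢
  linarith

/-- The triangular terms enter with total weight 1 and the diagonal term with weight `3/4`, whence
exactly `1 + 3/4 = 7/4`. -/
lemma squareNorm_walshTri_le (k : ℕ) :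
    ∀ n ≤ 2 ^ k, squareNorm (walshTri n) ≤ (7 / 4 : ℝ) ^ k := by
  induction k with
  | zero =>
    intro n hn
    have : n = 0 ∨ n = 1 := by simp at hn; omega
    rcases this with rfl | rfl <;>
      simp [walshTri_zero, walshTri_one, squareNorm_zero, squareNorm_one]
  | succ k ih =>
    intro n hn
    rw [pow_succ] at hn ⊢
    have hq : (0 : ℝ) < (7 / 4) ^ k := by positivity
    have hd := squareNorm_walshDiag_le k
    obtain ⟨m, rfl | rfl⟩ : ∃ m, n = 2 * m ∨ n = 2 * m + 1 := ⟨n / 2, by omega⟩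
    · rcases m with _ | m
      · simp only [Nat.mul_zero, walshTri_zero, squareNorm_zero]; positivity
      · have := squareNorm_walshTri_even_le m
        have := ih (m + 1) (by omega)
        have := ih m (by omega)
        have := hd (m + 1) (by omega)
        rw [show 2 * (m + 1) = 2 * m + 2 by ring]
        linarith
    · have := squareNorm_walshTri_odd_le m
      have := ih (m + 1) (by omega)
      have := ih m (by omega)
      have := hd (m + 1) (by omega)
      linarith

/-- On the quarter `r = r' = -1` the multiplier is `(1-z²)²`, without odd powers, hence the zero. -/
lemma squareNorm_walshFejer_even_le (m : ℕ) :
    squareNorm (walshFejer (2 * m + 2)) ≤ squareNorm (walshFejer (m + 1))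
      + squareNorm (walshFejer m) + squareNorm (walshTri (m + 1)) := by
  rw [squareNorm_eq_quarters (f₀₁ := fun p => 2 * walshTri (m + 1) p)
    (f₁₀ := fun p => 2 * walshTri (m + 1) p) (f₁₁ := fun p => 0)
    (integrable_walshFejer _)
    (fun p hp => (walshFejer_quarterMap hp two_pos two_pos m).1)
    (fun p hp => by
      rw [(walshFejer_quarterMap hp two_pos one_lt_two m).1, walshFejer_succ]; ring)
    (fun p hp => by
      rw [(walshFejer_quarterMap hp one_lt_two two_pos m).1, walshFejer_succ]; ring)
    (fun p hp => by
      rw [(walshFejer_quarterMap hp one_lt_two one_lt_two m).1]; ring)]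
  have h := squareNorm_mul_add_mul_le (integrable_walshFejer (m + 1))
    (integrable_walshFejer m) 4 4
  simp only [squareNorm_const_mul, squareNorm_zero]
  norm_num at h ⊢
  linarith

lemma squareNorm_walshFejer_odd_le (m : ℕ) :
    squareNorm (walshFejer (2 * m + 3)) ≤ (squareNorm (walshFejer (m + 2))
      + 6 * squareNorm (walshFejer (m + 1)) + squareNorm (walshFejer m)
      + 3 * squareNorm (walshTri (m + 2)) + 3 * squareNorm (walshTri (m + 1))) / 4 := by
  rw [squareNorm_eq_quarters
    (f₀₀ := fun p => (1 * walshFejer (m + 2) p + 6 * walshFejer (m + 1) p) + walshFejer m p)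
    (f₀₁ := fun p => 1 * walshTri (m + 2) p + 1 * walshTri (m + 1) p)
    (f₁₀ := fun p => 1 * walshTri (m + 2) p + 1 * walshTri (m + 1) p)
    (f₁₁ := fun p => 1 * walshTri (m + 2) p + (-1) * walshTri (m + 1) p)
    (integrable_walshFejer _)
    (fun p hp => by rw [(walshFejer_quarterMap hp two_pos two_pos m).2]; ring)
    (fun p hp => by
      rw [(walshFejer_quarterMap hp two_pos one_lt_two m).2, walshFejer_succ (m + 1),
        walshFejer_succ m]; ring)
    (fun p hp => by
      rw [(walshFejer_quarterMap hp one_lt_two two_pos m).2, walshFejer_succ (m + 1),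
        walshFejer_succ m]; ring)
    (fun p hp => by
      rw [(walshFejer_quarterMap hp one_lt_two one_lt_two m).2, walshFejer_succ (m + 1),
        walshFejer_succ m]; ring)]
  have hS := squareNorm_mul_add_mul_le (integrable_walshFejer (m + 2))
    (integrable_walshFejer (m + 1)) 1 6
  have hS' : squareNorm (fun p => (1 * walshFejer (m + 2) p + 6 * walshFejer (m + 1) p)
      + walshFejer m p) ≤ squareNorm (fun p => 1 * walshFejer (m + 2) p
      + 6 * walshFejer (m + 1) p) + squareNorm (walshFejer m) := squareNorm_add_le (((integrable_walshFejer (m + 2)).const_mul 1).add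
    ((integrable_walshFejer (m + 1)).const_mul 6)) (integrable_walshFejer m)
  have hT := squareNorm_mul_add_mul_le (integrable_walshTri (m + 2)) (integrable_walshTri (m + 1))
  have h1 := hT 1 1
  have h2 := hT 1 (-1)
  norm_num at hS hS' h1 h2 ⊢
  linarith

/-- With `q = 7/4` the worse (odd) case reads `F_{k+1} ≤ 2F_k + (3/2)q^k`. The solution of the
equality case with `F_0 = 1` is `7·2^k - 6q^k`. -/
lemma squareNorm_walshFejer_le (k : ℕ) :
    ∀ n ≤ 2 ^ k, squareNorm (walshFejer n) ≤ 7 * 2 ^ k - 6 * (7 / 4 : ℝ) ^ k := by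
  have hpos : ∀ k : ℕ, (1 : ℝ) ≤ 7 * 2 ^ k - 6 * (7 / 4 : ℝ) ^ k := fun k => by
    have h1 : (7 / 4 : ℝ) ^ k ≤ 2 ^ k := pow_le_pow_left₀ (by norm_num) (by norm_num) k
    have h2 : (1 : ℝ) ≤ 2 ^ k := one_le_pow₀ (by norm_num)
    linarith
  have h0 : squareNorm (walshFejer 0) = 0 := by rw [walshFejer_zero, squareNorm_zero]
  have h1 : squareNorm (walshFejer 1) = 1 := by rw [walshFejer_one, squareNorm_one]
  induction k with
  | zero =>
    intro n hn
    have : n = 0 ∨ n = 1 := by simp at hn; omega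
    rcases this with rfl | rfl <;> norm_num [h0, h1]
  | succ k ih =>
    intro n hn
    have hp := hpos (k + 1)
    rw [pow_succ] at hn
    rw [pow_succ, pow_succ] at hp ⊢
    have hq : (0 : ℝ) < (7 / 4) ^ k := by positivity
    have hd := squareNorm_walshTri_le k
    obtain rfl | rfl | ⟨m, rfl | rfl⟩ : n = 0 ∨ n = 1 ∨ ∃ m, n = 2 * m + 2 ∨ n = 2 * m + 3 := by
      rcases n with _ | _ | n
      · simp
      · simp
      · exact Or.inr (Or.inr ⟨n / 2, by omega⟩)
    · linarith
    · linarith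
    · have := squareNorm_walshFejer_even_le m
      have := ih (m + 1) (by omega)
      have := ih m (by omega)
      have := hd (m + 1) (by omega)
      linarith
    · have := squareNorm_walshFejer_odd_le m
      -- By parity, `2m + 3 ≤ 2·2^k` forces `m + 2 ≤ 2^k`.
      have := ih (m + 2) (by omega)
      have := ih (m + 1) (by omega)
      have := ih m (by omega)
      have := hd (m + 2) (by omega)
      have := hd (m + 1) (by omega)
      linarith

lemma squareNorm_walshFejer_le_linear (n : ℕ) :
    squareNorm (walshFejer n) ≤ 14 * ((n + 1 : ℕ) : ℝ) := by
  -- The chosen power of 2 lies above `n` but is at most `2(n + 1)`, hence `14 = 7·2`.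
  have h := squareNorm_walshFejer_le (Nat.log 2 (n + 1) + 1) n
    ((Nat.le_succ n).trans (Nat.lt_pow_succ_log_self one_lt_two (n + 1)).le)
  have hl : (2 ^ Nat.log 2 (n + 1) : ℝ) ≤ ((n + 1 : ℕ) : ℝ) := by
    exact_mod_cast Nat.pow_log_le_self 2 n.succ_ne_zero
  have hq : (0 : ℝ) < (7 / 4) ^ (Nat.log 2 (n + 1) + 1) := by positivity
  rw [pow_succ (2 : ℝ)] at h
  linarith

theorem corollary2 :
    ∃ C : ℝ, ∀ n : ℕ, 1 ≤ n →
      MemLp (triangularFejerKernel n) 1 (volume.restrict unitSquare) ∧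
        eLpNorm (triangularFejerKernel n) 1 (volume.restrict unitSquare) ≤ ENNReal.ofReal C := by
  refine ⟨14, fun n hn => ?_⟩
  obtain ⟨n, rfl⟩ : ∃ m, n = m + 1 := ⟨n - 1, by omega⟩
  have hK : triangularFejerKernel (n + 1) = fun p => (1 / ((n + 1 : ℕ) : ℝ)) * walshFejer n p :=
    funext (triangularFejerKernel_succ n)
  have hi : Integrable (triangularFejerKernel (n + 1)) squareMeasure :=
    hK ▸ (integrable_walshFejer n).const_mul _
  refine ⟨memLp_one_iff_integrable.2 hi, ?_⟩
  rw [eLpNorm_one_eq_lintegral_enorm, ← ofReal_integral_norm_eq_lintegral_enorm hi]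
  refine ENNReal.ofReal_le_ofReal ?_
  change squareNorm (triangularFejerKernel (n + 1)) ≤ 14
  have hn : (0 : ℝ) < ((n + 1 : ℕ) : ℝ) := by positivity
  rw [hK, squareNorm_const_mul, abs_of_pos (by positivity), one_div, inv_mul_le_iff₀ hn, mul_comm]
  exact squareNorm_walshFejer_le_linear n
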